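/- **Setting.** Let $\mathcal N$ be a smooth $\mathfrak n$-manifold. *Hypersurface data* $\mathcal D=\{\mathcal N,\gamma,\boldsymbol\ell,\ell^{(2)},\mathbf Y\}$ consists of a smooth symmetric 2-covariant tensor $\gamma$, a one-form $\boldsymbol\ell$, a function $\ell^{(2)}$ and a symmetric 2-covariant tensor $\mathbf Y$ on $\mathcal N$ such that the bilinear form $\mathcal A((W,a),(Z,b))=\gamma(W,Z)+a\boldsymbol\ell(Z)+b\boldsymbol\ell(W)+ab\,\ell^{(2)}$ on $T_p\mathcal N\times\mathbb R$ is non-degenerate at every $p$. The vector field $n$ and the function $n^{(2)}$ are uniquely determined by $\gamma(n,\cdot)+n^{(2)}\boldsymbol\ell=0$ and $\boldsymbol\ell(n)+n^{(2)}\ell^{(2)}=1$; the data is *null* if $n^{(2)}=0$ everywhere, and its *surface gravity* is $-\mathbf Y(n,n)$. For a nowhere zero smooth function $z$ and a smooth vector field $V$, the gauge transformed data $\mathcal G_{(z,V)}(\mathcal D)$ is $$\gamma,\qquad z(\boldsymbol\ell+\gamma(V,\cdot)),\qquad z^2(\ell^{(2)}+2\boldsymbol\ell(V)+\gamma(V,V)),\qquad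 z\mathbf Y+\boldsymbol\ell\otimes_s dz+\tfrac12\pounds_{zV}\gamma .$$ The data is *embedded* in a semi-Riemannian manifold $(\mathcal M,g)$ with embedding $\iota$ and rigging $L$ (a smooth vector field along $\iota$, everywhere transversal to $\iota(\mathcal N)$) if $\gamma=\iota^\star g$, $\boldsymbol\ell=\iota^\star(g(L,\cdot))$, $\ell^{(2)}=\iota^\star(g(L,L))$ and $\mathbf Y=\frac12\iota^\star(\pounds_L g)$. **Hypotheses.** Let $\mathcal D=\{\mathcal N,\gamma,\boldsymbol\ell,\ell^{(2)},\mathbf Y^-\}$ and $\widehat{\mathcal D}=\{\mathcal N,\widehat\gamma,\widehat{\boldsymbol\ell},\widehat\ell^{(2)},\widehat{\mathbf Y}^+\}$ be null hypersurface data embedded, with embeddings $\iota^\mp$ and riggings $L^\mp$ respectively ($-$ for $\mathcal D$, $+$ for $\widehat{\mathcal D}$), in $(\mathfrak n+1)$-dimensional Lorentzian manifolds with boundary $(\mathcal M^\mp,g^\mp)$ such that $\iota^\pm(\mathcal N)=\partial\mathcal M^\pm$. Let $\epsilon^\pm=+1$ if $L^\pm$ points outwards and $\epsilon^\pm=-1$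 if it points inwards. Assume that the matching conditions hold for a diffeomorphism $\varphi:\mathcal N\to\mathcal N$, a nowhere zero smooth function $z$ and a smooth vector field $V$: (i) the metric parts (the first three entries) of $\mathcal G_{(z,V)}(\varphi^\star\widehat{\mathcal D})$ and of $\mathcal D$ coincide; (ii) $\operatorname{sign}(z)=-\operatorname{sign}(\epsilon^+)\operatorname{sign}(\epsilon^-)$. Let $\xi^+$ be the vector field along $\iota^+\circ\varphi$ given by $\xi^+=z\,\big(L^++\iota^+_\star(\varphi_\star V)\big)$ (with $L^+$ and $\iota^+_\star\varphi_\star V$ taken at the image point), let $\mathbf Y^+=\frac12(\iota^+\circ\varphi)^\star(\pounds_{\xi^+}g^+)$ and $[\mathbf Y]=\mathbf Y^+-\mathbf Y^-$, and let $\epsilon=\epsilon^-$. The *pressure* of the resulting null shell is $p=-\epsilon\,[\mathbf Y](n,n)$. Write $$\kappa_n=-\mathbf Y^-(n,n),\qquad \widehat\kappa_n=-\widehat{\mathbf Y}^+(\widehat n,\widehat n),\qquad \varphi^\star\kappa_{\varphi_\star n}=\frac1z\big(\varphi^\star\widehat\kappa_n-n(z)\big)$$ for the surface gravities of $n$, of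 $\widehat n$ (the field $n$ of $\widehat{\mathcal D}$) and of $\varphi_\star n$ (the last one pulled back by $\varphi$). For a smooth vector field $\overline V$ let $\mathcal G_{(z,\overline V)}(\varphi^\star\widehat\kappa_n)$ be the surface gravity of the gauge transformed data $\mathcal G_{(z,\overline V)}(\varphi^\star\widehat{\mathcal D})$. **Lemma.** One has $z=1/\big((\varphi^\star\widehat{\boldsymbol\ell})(n)\big)$, and for every smooth vector field $\overline V$ on $\mathcal N$ $$p=-\epsilon\big(\kappa_n-\mathcal G_{(z,\overline V)}(\varphi^\star\widehat\kappa_n)\big)\qquad\text{and}\qquad p=-\epsilon\big(\kappa_n-\varphi^\star\kappa_{\varphi_\star n}\big).$$ In particular, at each point of $\mathcal N$ (hence also identically on $\mathcal N$), $p=0$ if and only if $\mathcal G_{(z,\overline V)}(\varphi^\star\widehat\kappa_n)=\kappa_n$, and equivalently if and only if $\varphi^\star\kappa_{\varphi_\star n}=\kappa_n$. -/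

import Mathlib

open Set Manifold Bundle
open scoped ContDiff Topology

noncomputable section

namespace NullShell

section Tensors

variable {E : Type*} [NormedAddCommGroup E] [NormedSpace ℝ E]
  {H : Type*} [TopologicalSpace H] (I : ModelWithCorners ℝ E H)
  {M : Type*} [TopologicalSpace M] [ChartedSpace H M]
  {E' : Type*} [NormedAddCommGroup E'] [NormedSpace ℝ E']
  {H' : Type*} [TopologicalSpace H'] (I' : ModelWithCorners ℝ E' H')
  {M' : Type*} [TopologicalSpace M'] [ChartedSpace H' M']

/-- `pullBilin B A C` is the bilinear form `(u, v) ↦ B (A u) (C v)`. -/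
def pullBilin (B : E' →L[ℝ] E' →L[ℝ] ℝ) (A C : E →L[ℝ] E') : E →L[ℝ] E →L[ℝ] ℝ :=
  B.bilinearComp A C

@[simp] theorem pullBilin_apply (B : E' →L[ℝ] E' →L[ℝ] ℝ) (A C : E →L[ℝ] E') (u v : E) :
    pullBilin B A C u v = B (A u) (C v) := rfl

variable (M) in
/-- Vector fields on `M` (no regularity). -/
abbrev VField : Type _ := ∀ x : M, TangentSpace I x

variable (M) in
/-- One-forms on `M` (no regularity). -/
abbrev OneForm : Type _ := ∀ x : M, TangentSpace I x →L[ℝ] ℝ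

variable (M) in
/-- `2`-covariant tensor fields on `M` (no regularity). -/
abbrev Tensor2 : Type _ := ∀ x : M, TangentSpace I x →L[ℝ] TangentSpace I x →L[ℝ] ℝ

/-- Smoothness of a vector field. -/
def SmoothVField [IsManifold I ∞ M] (V : VField I M) : Prop :=
  ContMDiff I I.tangent ∞ (fun x => (⟨x, V x⟩ : TangentBundle I M))

/-- Smoothness of a vector field along a map `f : M → M'`. -/
def SmoothVFieldAlong [IsManifold I' ∞ M'] (f : M → M') (ζ : ∀ x : M, TangentSpace I' (f x)) : Prop :=
  ContMDiff I I'.tangent ∞ (fun x => (⟨f x, ζ x⟩ : TangentBundle I' M'))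

/-- Smoothness of a one-form. -/
def SmoothOneForm [IsManifold I ∞ M] (θ : OneForm I M) : Prop :=
  ContMDiff I (I.prod 𝓘(ℝ, E →L[ℝ] ℝ)) ∞
    (fun x => TotalSpace.mk' (E →L[ℝ] ℝ)
      (E := fun x : M => TangentSpace I x →L[ℝ] ℝ) x (θ x))

/-- Smoothness of a `2`-covariant tensor field. -/
def SmoothTensor2 [IsManifold I ∞ M] (T : Tensor2 I M) : Prop :=
  ContMDiff I (I.prod 𝓘(ℝ, E →L[ℝ] E →L[ℝ] ℝ)) ∞
    (fun x => TotalSpace.mk' (E →L[ℝ] E →L[ℝ] ℝ)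
      (E := fun x : M => TangentSpace I x →L[ℝ] TangentSpace I x →L[ℝ] ℝ) x (T x))

/-- Differential of a scalar function. -/
def dScalar (f : M → ℝ) : OneForm I M := fun x => mfderiv I 𝓘(ℝ, ℝ) f x

/-- Pull-back `f^* T` of a `2`-covariant tensor field. -/
def pullTensor2 (T : Tensor2 I' M') (f : M → M') : Tensor2 I M := fun x =>
  pullBilin (E := E) (E' := E') (T (f x)) (mfderiv I I' f x) (mfderiv I I' f x)

/-- Pull-back `f^* θ` of a one-form. -/
def pullOneForm (θ : OneForm I' M') (f : M → M') : OneForm I M := fun x =>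
  (θ (f x)).comp (mfderiv I I' f x)

/-- Symmetrized tensor product `α ⊗ₛ β = ½ (α ⊗ β + β ⊗ α)` of one-forms. -/
def symProd (α β : OneForm I M) : Tensor2 I M := fun x =>
  (1 / 2 : ℝ) • ((α x).smulRight (β x) + (β x).smulRight (α x))

/-- The components `T_ab(y)` of a `2`-covariant tensor field in the preferred chart at `x₀`, as a
function of the coordinates `y`. -/
def tensorCoord [IsManifold I ∞ M] (T : Tensor2 I M) (x₀ : M) (y : E) : E →L[ℝ] E →L[ℝ] ℝ :=
  pullBilin (E := E) (E' := E) (T ((extChartAt I x₀).symm y))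
    (tangentCoordChange I x₀ ((extChartAt I x₀).symm y) ((extChartAt I x₀).symm y))
    (tangentCoordChange I x₀ ((extChartAt I x₀).symm y) ((extChartAt I x₀).symm y))

/-- The components `ζ^a` in the preferred chart at `x₀` of a vector field `ζ` along `f`. -/
def vectorCoord [IsManifold I' ∞ M'] (f : M → M') (ζ : ∀ x : M, TangentSpace I' (f x)) (x₀ : M') (q : M) : E' :=
  tangentCoordChange I' (f q) x₀ (f q) (ζ q)

/-- The Lie derivative `£_Z T` of a `2`-covariant tensor field along a vector field, by the
coordinate formula `(£_Z T)_ab = Z^c ∂_c T_ab + T_cb ∂_a Z^c + T_ac ∂_b Z^c`, evaluated at `x` in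
the preferred chart at `x` (the chart in which `TangentSpace I x` is identified with `E`). -/
def lieDeriv [IsManifold I ∞ M] (T : Tensor2 I M) (Z : VField I M) : Tensor2 I M := fun x =>
  (fderivWithin ℝ (tensorCoord I T x) (range I) (extChartAt I x x) (Z x)
    + pullBilin (E := E) (E' := E) (T x)
        (mfderiv I 𝓘(ℝ, E) (vectorCoord I (fun q : M => q) Z x) x) (ContinuousLinearMap.id ℝ E)
    + pullBilin (E := E) (E' := E) (T x)
        (ContinuousLinearMap.id ℝ E) (mfderiv I 𝓘(ℝ, E) (vectorCoord I (fun q : M => q) Z x) x) :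
    E →L[ℝ] E →L[ℝ] ℝ)

/-- The pull-back `f^* (£_ζ T)` of the Lie derivative of a `2`-covariant tensor field `T` on `M'`
along a vector field `ζ` that is only given along a map `f : M → M'`:
`ζ^c ∂_c T_ab (∂_i f^a) (∂_j f^b) + T_cb (∂_i ζ^c) (∂_j f^b) + T_ac (∂_i f^a) (∂_j ζ^c)`.
It equals `f^* (£_Z T)` for every extension `Z` of `ζ` off `f(M)`, see
`lieDerivAlong_eq_pullTensor2_lieDeriv`. -/
def lieDerivAlong [IsManifold I' ∞ M'] (T : Tensor2 I' M') (f : M → M')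
    (ζ : ∀ x : M, TangentSpace I' (f x)) : Tensor2 I M := fun x =>
  (pullBilin (E := E) (E' := E')
      (fderivWithin ℝ (tensorCoord I' T (f x)) (range I') (extChartAt I' (f x) (f x)) (ζ x))
      (mfderiv I I' f x) (mfderiv I I' f x)
    + pullBilin (E := E) (E' := E') (T (f x))
        (mfderiv I 𝓘(ℝ, E') (vectorCoord I' f ζ (f x)) x) (mfderiv I I' f x)
    + pullBilin (E := E) (E' := E') (T (f x))
        (mfderiv I I' f x) (mfderiv I 𝓘(ℝ, E') (vectorCoord I' f ζ (f x)) x) :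
    E →L[ℝ] E →L[ℝ] ℝ)

variable {I I'} [IsManifold I' ∞ M']

theorem mdifferentiableAt_vectorCoord {f : M → M'} {ζ : ∀ x : M, TangentSpace I' (f x)} {x : M}
    (hζ : MDifferentiableAt I I'.tangent (fun q => (⟨f q, ζ q⟩ : TangentBundle I' M')) x) :
    MDifferentiableAt I 𝓘(ℝ, E') (vectorCoord I' f ζ (f x)) x := by
  exact ((mdifferentiableAt_totalSpace _ _).1 hζ).2

/-- Independence of the extension: `lieDerivAlong` is the pull-back of `£_Z T` for every local
extension `Z` of `ζ`. -/
theorem lieDerivAlong_eq_pullTensor2_lieDeriv {T : Tensor2 I' M'} {f : M → M'}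
    {ζ : ∀ x : M, TangentSpace I' (f x)} {Z : VField I' M'} {x : M}
    (hf : MDifferentiableAt I I' f x)
    (hZ : MDifferentiableAt I' I'.tangent (fun y => (⟨y, Z y⟩ : TangentBundle I' M')) (f x))
    (hext : ∀ᶠ q in 𝓝 x, ζ q = Z (f q)) :
    lieDerivAlong I I' T f ζ x = pullTensor2 I I' (lieDeriv I' T Z) f x := by
  have h1 : vectorCoord I' f ζ (f x) =ᶠ[𝓝 x] vectorCoord I' (fun q : M' => q) Z (f x) ∘ f := by
    filter_upwards [hext] with q hq
    simp [vectorCoord, hq]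
  have h2 := mdifferentiableAt_vectorCoord (f := fun q : M' => q) hZ
  have h3 : mfderiv I 𝓘(ℝ, E') (vectorCoord I' f ζ (f x)) x
      = (mfderiv I' 𝓘(ℝ, E') (vectorCoord I' (fun q : M' => q) Z (f x)) (f x)).comp
        (mfderiv I I' f x) := by
    rw [h1.mfderiv_eq]
    exact mfderiv_comp x h2 hf
  have h4 := hext.self_of_nhds
  ext u v
  simp only [lieDerivAlong, lieDeriv, pullTensor2, h4, h3]
  rfl

/-- Naturality of `lieDerivAlong` under composition with a map on the source side. -/
theorem lieDerivAlong_comp {E₀ : Type*} [NormedAddCommGroup E₀] [NormedSpace ℝ E₀]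
    {H₀ : Type*} [TopologicalSpace H₀] {I₀ : ModelWithCorners ℝ E₀ H₀}
    {M₀ : Type*} [TopologicalSpace M₀] [ChartedSpace H₀ M₀]
    {T : Tensor2 I' M'} {f : M → M'} {ζ : ∀ x : M, TangentSpace I' (f x)} {h : M₀ → M} {x : M₀}
    (hh : MDifferentiableAt I₀ I h x) (hf : MDifferentiableAt I I' f (h x))
    (hζ : MDifferentiableAt I I'.tangent (fun q => (⟨f q, ζ q⟩ : TangentBundle I' M')) (h x)) :
    lieDerivAlong I₀ I' T (fun q => f (h q)) (fun q => ζ (h q)) x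
      = pullTensor2 I₀ I (lieDerivAlong I I' T f ζ) h x := by
  have h1 : mfderiv I₀ 𝓘(ℝ, E') (vectorCoord I' (fun q => f (h q)) (fun q => ζ (h q)) (f (h x))) x
      = (mfderiv I 𝓘(ℝ, E') (vectorCoord I' f ζ (f (h x))) (h x)).comp (mfderiv I₀ I h x) :=
    mfderiv_comp x (mdifferentiableAt_vectorCoord hζ) hh
  have h2 : mfderiv I₀ I' (fun q => f (h q)) x = (mfderiv I I' f (h x)).comp (mfderiv I₀ I h x) :=
    mfderiv_comp x hf hh
  ext u v
  simp only [lieDerivAlong, pullTensor2, h1, h2]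
  rfl

end Tensors

section HypersurfaceData

/-- The fields `{γ, ℓ, ℓ⁽²⁾, Y}` of hypersurface data on an `n`-manifold `N`; the conditions they
satisfy are in `IsHypersurfaceData`. -/
@[ext] structure HypersurfaceData (n : ℕ) (N : Type*) [TopologicalSpace N]
    [ChartedSpace (EuclideanSpace ℝ (Fin n)) N] where
  /-- the tensor `γ` -/
  γ : Tensor2 (𝓡 n) N
  /-- the one-form `ℓ` -/
  ell : OneForm (𝓡 n) N
  /-- the scalar `ℓ⁽²⁾` -/
  ell2 : N → ℝ
  /-- the transverse tensor `Y` -/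
  Y : Tensor2 (𝓡 n) N

variable {n : ℕ} {N : Type*} [TopologicalSpace N] [ChartedSpace (EuclideanSpace ℝ (Fin n)) N]

namespace HypersurfaceData

/-- The bilinear form `𝓐_p((W,a),(Z,b)) = γ(W,Z) + a ℓ(Z) + b ℓ(W) + a b ℓ⁽²⁾` on `T_pN × ℝ`. -/
def ambient (D : HypersurfaceData n N) (p : N) (w w' : TangentSpace (𝓡 n) p × ℝ) : ℝ :=
  D.γ p w.1 w'.1 + w.2 * D.ell p w'.1 + w'.2 * D.ell p w.1 + w.2 * w'.2 * D.ell2 p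

/-- `(n, n⁽²⁾)` at `p` solves `γ(n,·) + n⁽²⁾ ℓ = 0` and `ℓ(n) + n⁽²⁾ ℓ⁽²⁾ = 1`. -/
def IsNormalPair (D : HypersurfaceData n N) (p : N) (w : TangentSpace (𝓡 n) p × ℝ) : Prop :=
  (∀ Z : TangentSpace (𝓡 n) p, D.γ p w.1 Z + w.2 * D.ell p Z = 0) ∧
    D.ell p w.1 + w.2 * D.ell2 p = 1

/-- The pair `(n, n⁽²⁾)` at `p`. -/
def normalPair (D : HypersurfaceData n N) (p : N) : TangentSpace (𝓡 n) p × ℝ :=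
  Classical.epsilon (D.IsNormalPair p)

/-- The vector field `n`. -/
def normal (D : HypersurfaceData n N) : VField (𝓡 n) N := fun p => (D.normalPair p).1

/-- The scalar `n⁽²⁾`. -/
def normal2 (D : HypersurfaceData n N) : N → ℝ := fun p => (D.normalPair p).2

/-- The surface gravity `κ_n = - Y(n, n)`. -/
def surfaceGravity (D : HypersurfaceData n N) : N → ℝ := fun p => - D.Y p (D.normal p) (D.normal p)

/-- The pulled back data `φ^* D`. -/
def pullback (D : HypersurfaceData n N) (φ : N → N) : HypersurfaceData n N where
  γ := pullTensor2 (𝓡 n) (𝓡 n) D.γ φ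
  ell := pullOneForm (𝓡 n) (𝓡 n) D.ell φ
  ell2 := fun p => D.ell2 (φ p)
  Y := pullTensor2 (𝓡 n) (𝓡 n) D.Y φ

variable [IsManifold (𝓡 n) ∞ N]

/-- The gauge transformed data `𝒢_(z,V)(D)`. -/
def gauge (z : N → ℝ) (V : VField (𝓡 n) N) (D : HypersurfaceData n N) :
    HypersurfaceData n N where
  γ := D.γ
  ell := fun p => z p • (D.ell p + D.γ p (V p))
  ell2 := fun p => z p ^ 2 * (D.ell2 p + 2 * D.ell p (V p) + D.γ p (V p) (V p))
  Y := fun p => z p • D.Y p + symProd (𝓡 n) D.ell (dScalar (𝓡 n) z) p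
    + (1 / 2 : ℝ) • lieDeriv (𝓡 n) D.γ (fun q => z q • V q) p

end HypersurfaceData

/-- Hypersurface data: smooth fields, with `γ` and `Y` symmetric and `𝓐` non-degenerate. -/
structure IsHypersurfaceData [IsManifold (𝓡 n) ∞ N] (D : HypersurfaceData n N) : Prop where
  smooth_γ : SmoothTensor2 (𝓡 n) D.γ
  smooth_ell : SmoothOneForm (𝓡 n) D.ell
  smooth_ell2 : ContMDiff (𝓡 n) 𝓘(ℝ, ℝ) ∞ D.ell2
  smooth_Y : SmoothTensor2 (𝓡 n) D.Y
  symm_γ : ∀ p u v, D.γ p u v = D.γ p v u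
  symm_Y : ∀ p u v, D.Y p u v = D.Y p v u
  nondegenerate : ∀ p w, (∀ w', D.ambient p w w' = 0) → w = 0

/-- Null hypersurface data: `n⁽²⁾ = 0` everywhere. -/
structure IsNullHypersurfaceData [IsManifold (𝓡 n) ∞ N] (D : HypersurfaceData n N) : Prop
    extends IsHypersurfaceData D where
  null : ∀ p, D.normal2 p = 0

theorem HypersurfaceData.isNormalPair_iff {D : HypersurfaceData n N} {p : N}
    {w : TangentSpace (𝓡 n) p × ℝ} : D.IsNormalPair p w ↔ ∀ w', D.ambient p w w' = w'.2 := by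
  constructor
  · rintro ⟨h1, h2⟩ w'
    have := h1 w'.1
    simp only [HypersurfaceData.ambient]
    linear_combination this + w'.2 * h2
  · intro h
    refine ⟨fun Z => ?_, ?_⟩
    · simpa [HypersurfaceData.ambient] using h (Z, 0)
    · simpa [HypersurfaceData.ambient] using h (0, 1)

/-- Non-degeneracy of `𝓐` makes `(n, n⁽²⁾)` well defined. -/
theorem IsHypersurfaceData.existsUnique_isNormalPair [IsManifold (𝓡 n) ∞ N]
    {D : HypersurfaceData n N} (h : IsHypersurfaceData D) (p : N) : ∃! w, D.IsNormalPair p w := by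
  have : FiniteDimensional ℝ (TangentSpace (𝓡 n) p) :=
    inferInstanceAs (FiniteDimensional ℝ (EuclideanSpace ℝ (Fin n)))
  let B : (TangentSpace (𝓡 n) p × ℝ) →ₗ[ℝ] Module.Dual ℝ (TangentSpace (𝓡 n) p × ℝ) :=
    LinearMap.mk₂ ℝ (D.ambient p)
      (by intros; simp only [HypersurfaceData.ambient, Prod.fst_add, Prod.snd_add, map_add,
            add_apply]; ring)
      (by intros; simp only [HypersurfaceData.ambient, Prod.smul_fst, Prod.smul_snd, map_smul,
            smul_apply, smul_eq_mul]; ring)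
      (by intros; simp only [HypersurfaceData.ambient, Prod.fst_add, Prod.snd_add, map_add]; ring)
      (by intros; simp only [HypersurfaceData.ambient, Prod.smul_fst, Prod.smul_snd, map_smul,
            smul_eq_mul]; ring)
  have hinj : Function.Injective B := by
    rw [← LinearMap.ker_eq_bot, LinearMap.ker_eq_bot']
    intro w hw
    exact h.nondegenerate p w fun w' => LinearMap.congr_fun hw w'
  have hsurj : Function.Surjective B :=
    (LinearMap.injective_iff_surjective_of_finrank_eq_finrank Subspace.dual_finrank_eq.symm).1 hinj
  obtain ⟨w, hw⟩ := hsurj (LinearMap.snd ℝ _ _)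
  refine ⟨w, HypersurfaceData.isNormalPair_iff.2 fun w' => LinearMap.congr_fun hw w', ?_⟩
  intro w₂ hw₂
  apply hinj
  rw [hw]
  exact LinearMap.ext fun w' => HypersurfaceData.isNormalPair_iff.1 hw₂ w'

theorem IsHypersurfaceData.isNormalPair_normalPair [IsManifold (𝓡 n) ∞ N]
    {D : HypersurfaceData n N} (h : IsHypersurfaceData D) (p : N) :
    D.IsNormalPair p (D.normalPair p) :=
  Classical.epsilon_spec (h.existsUnique_isNormalPair p).exists

end HypersurfaceData

section Embedded

variable {n : ℕ} {N : Type*} [TopologicalSpace N] [ChartedSpace (EuclideanSpace ℝ (Fin n)) N]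
  [IsManifold (𝓡 n) ∞ N]
  {M : Type*} [TopologicalSpace M] [ChartedSpace (EuclideanHalfSpace (n + 1)) M]
  [IsManifold (𝓡∂ (n + 1)) ∞ M]

/-- `g` is a smooth Lorentzian metric, of signature `(-,+,…,+)`, on the `(n+1)`-manifold with
boundary `M`. -/
structure IsLorentzMetric (g : Tensor2 (𝓡∂ (n + 1)) M) : Prop where
  smooth : SmoothTensor2 (𝓡∂ (n + 1)) g
  symm : ∀ x u v, g x u v = g x v u
  signature : ∀ x, ∃ b : Module.Basis (Fin (n + 1)) ℝ (TangentSpace (𝓡∂ (n + 1)) x),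
    ∀ i j, g x (b i) (b j) = if i = j then (if i = 0 then -1 else 1) else 0

/-- The vector `v` at `x` points outwards: its component transverse to the boundary is negative in
the preferred half-space chart `{y | 0 ≤ y 0}` at `x`. Meaningful at boundary points. -/
def PointsOutward (x : M) (v : TangentSpace (𝓡∂ (n + 1)) x) : Prop :=
  let w : EuclideanSpace ℝ (Fin (n + 1)) := v
  w 0 < 0

/-- The vector `v` at `x` points inwards. Meaningful at boundary points. -/
def PointsInward (x : M) (v : TangentSpace (𝓡∂ (n + 1)) x) : Prop :=
  let w : EuclideanSpace ℝ (Fin (n + 1)) := v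
  0 < w 0

/-- `ε = +1` if the rigging `L` points outwards, `ε = -1` if it points inwards. -/
def IsRiggingSign (ι : N → M) (L : ∀ p : N, TangentSpace (𝓡∂ (n + 1)) (ι p)) (ε : ℝ) : Prop :=
  (ε = 1 ∧ ∀ p, PointsOutward (ι p) (L p)) ∨ (ε = -1 ∧ ∀ p, PointsInward (ι p) (L p))

/-- The hypersurface data induced on `N` by a map `f : N → M` and a vector field `ζ` along it:
`γ = f^* g`, `ℓ = f^*(g(ζ,·))`, `ℓ⁽²⁾ = f^*(g(ζ,ζ))` and `Y = ½ f^*(£_ζ g)`. -/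
def inducedData (g : Tensor2 (𝓡∂ (n + 1)) M) (f : N → M)
    (ζ : ∀ p : N, TangentSpace (𝓡∂ (n + 1)) (f p)) : HypersurfaceData n N where
  γ := pullTensor2 (𝓡 n) (𝓡∂ (n + 1)) g f
  ell := fun p => (g (f p) (ζ p)).comp (mfderiv (𝓡 n) (𝓡∂ (n + 1)) f p)
  ell2 := fun p => g (f p) (ζ p) (ζ p)
  Y := fun p => (1 / 2 : ℝ) • lieDerivAlong (𝓡 n) (𝓡∂ (n + 1)) g f ζ p

/-- The hypersurface data `D` is `{ι, L}`-embedded in `(M, g)`: `ι` is an embedding, `L` is a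
rigging along it (smooth and everywhere transversal), and `D` is induced by `ι` and `L`. -/
structure IsEmbedded (D : HypersurfaceData n N) (g : Tensor2 (𝓡∂ (n + 1)) M) (ι : N → M)
    (L : ∀ p : N, TangentSpace (𝓡∂ (n + 1)) (ι p)) : Prop where
  smooth : ContMDiff (𝓡 n) (𝓡∂ (n + 1)) ∞ ι
  isEmbedding : Topology.IsEmbedding ι
  immersion : ∀ p, Function.Injective (mfderiv (𝓡 n) (𝓡∂ (n + 1)) ι p)
  smooth_rigging : SmoothVFieldAlong (𝓡 n) (𝓡∂ (n + 1)) ι L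
  transversal : ∀ p, L p ∉ Set.range (mfderiv (𝓡 n) (𝓡∂ (n + 1)) ι p)
  induced : D = inducedData g ι L

/-- The rigging `ξ⁺ = z' (L⁺ + ι_*(φ_* V))`, where `z' ∘ ι ∘ φ = z`, as a vector field along the
embedding `ι ∘ φ`. -/
def matchingRigging (ι : N → M) (L : ∀ p : N, TangentSpace (𝓡∂ (n + 1)) (ι p)) (φ : N → N)
    (z : N → ℝ) (V : VField (𝓡 n) N) (p : N) : TangentSpace (𝓡∂ (n + 1)) (ι (φ p)) :=
  z p • (L (φ p) + mfderiv (𝓡 n) (𝓡∂ (n + 1)) ι (φ p) (mfderiv (𝓡 n) (𝓡 n) φ p (V p)))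

/-- The transverse tensor `Y⁺ = ½ (ι ∘ φ)^*(£_ξ⁺ g⁺)` of the plus side of the shell. -/
def plusTensor (g : Tensor2 (𝓡∂ (n + 1)) M) (ι : N → M)
    (L : ∀ p : N, TangentSpace (𝓡∂ (n + 1)) (ι p)) (φ : N → N)
    (z : N → ℝ) (V : VField (𝓡 n) N) : Tensor2 (𝓡 n) N :=
  (inducedData g (fun p => ι (φ p)) (matchingRigging ι L φ z V)).Y

/-- The pressure `p = -ε [Y](n,n)`, `[Y] = Y⁺ - Y⁻`, of the null shell with metric hypersurface data
and tensor `Y⁻` those of `D`, and with `Y⁺ = Yplus`. -/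
def pressure (D : HypersurfaceData n N) (Yplus : Tensor2 (𝓡 n) N) (ε : ℝ) (p : N) : ℝ :=
  -ε * (Yplus p - D.Y p) (D.normal p) (D.normal p)

/-- `φ^* κ_(φ_* n) = (1/z) (φ^* κ̂ - n(z))`, where `κ̂` is the surface gravity of `D'` and `n` is
the normal field of `D`. -/
def pushSurfaceGravity (D D' : HypersurfaceData n N) (φ : N → N) (z : N → ℝ) (p : N) : ℝ :=
  1 / z p * (D'.surfaceGravity (φ p) - dScalar (𝓡 n) z p (D.normal p))

/-- The metric parts of `𝒢_(z,V)(φ^* D')` and of `D` agree, with `z` a smooth nowhere zero function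
and `V` a smooth vector field, and with `φ` a diffeomorphism. -/
structure IsMatchingGauge (D D' : HypersurfaceData n N) (φ : Diffeomorph (𝓡 n) (𝓡 n) N N ∞)
    (z : N → ℝ) (V : VField (𝓡 n) N) : Prop where
  smooth_z : ContMDiff (𝓡 n) 𝓘(ℝ, ℝ) ∞ z
  z_ne_zero : ∀ p, z p ≠ 0
  smooth_V : SmoothVField (𝓡 n) V
  γ_eq : ((D'.pullback φ).gauge z V).γ = D.γ
  ell_eq : ((D'.pullback φ).gauge z V).ell = D.ell
  ell2_eq : ((D'.pullback φ).gauge z V).ell2 = D.ell2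

end Embedded

end NullShell

end

noncomputable section

namespace NullShell

section NormedSpace

variable {E F : Type*} [NormedAddCommGroup E] [NormedSpace ℝ E]
  [NormedAddCommGroup F] [NormedSpace ℝ F]

/-- Solutions of `B y (v y) = w` depend continuously on `y` at a point where `B y` is injective. -/
theorem tendsto_of_apply_eq_of_injective [FiniteDimensional ℝ E] {B : E → E →L[ℝ] F} {y₀ : E}
    (hB : ContinuousAt B y₀) (hinj : Function.Injective (B y₀)) {v : E → E} {w : F} {v₀ : E}
    (hv : ∀ᶠ y in 𝓝 y₀, B y (v y) = w) (hv₀ : B y₀ v₀ = w) :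
    Filter.Tendsto v (𝓝 y₀) (𝓝 v₀) := by
  obtain ⟨K, hK, hanti⟩ := (B y₀).toLinearMap.exists_antilipschitzWith
    (LinearMap.ker_eq_bot.2 hinj)
  have hbound : ∀ u, ‖u‖ ≤ K * ‖B y₀ u‖ := fun u => by
    simpa using hanti.le_mul_dist u 0
  have hlim : Filter.Tendsto (fun y => K * ‖B y₀ - B y‖) (𝓝 y₀) (𝓝 0) := by
    have : ContinuousAt (fun y => (K : ℝ) * ‖B y₀ - B y‖) y₀ := by fun_prop
    simpa [ContinuousAt] using this
  have hsmall : ∀ᶠ y in 𝓝 y₀, K * ‖B y₀ - B y‖ < 1 / 2 :=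
    hlim.eventually (gt_mem_nhds (by norm_num))
  rw [tendsto_iff_norm_sub_tendsto_zero]
  refine squeeze_zero' (g := fun y => 2 * (K * ‖B y₀ - B y‖) * ‖v₀‖)
    (.of_forall fun _ => norm_nonneg _) ?_ ?_
  · filter_upwards [hv, hsmall] with y hy hs
    have h1 : B y₀ (v y - v₀) = (B y₀ - B y) (v y) := by
      simp [hy, hv₀]
    have h2 : ‖v y - v₀‖ ≤ K * ‖B y₀ - B y‖ * ‖v y‖ := by
      refine (hbound _).trans ?_
      rw [h1, mul_assoc]
      gcongr
      exact ContinuousLinearMap.le_opNorm _ _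
    have h3 : ‖v y‖ ≤ ‖v y - v₀‖ + ‖v₀‖ := by
      simpa using norm_add_le (v y - v₀) v₀
    have h4 : 0 ≤ K * ‖B y₀ - B y‖ := by positivity
    nlinarith [norm_nonneg (v y - v₀), norm_nonneg v₀, norm_nonneg (v y),
      mul_le_mul_of_nonneg_left h3 h4]
  · simpa using (hlim.const_mul 2).mul_const ‖v₀‖

set_option synthInstance.maxHeartbeats 200000 in
/-- A field of symmetric bilinear forms whose radical is, near `y₀`, normalised by a one-form `l` and
spanned at `y₀` by `k y₀` has vanishing derivative at `y₀` on the radical. -/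
theorem fderiv_radical_eq_zero [FiniteDimensional ℝ E] {G : E → E →L[ℝ] E →L[ℝ] ℝ}
    {l : E → E →L[ℝ] ℝ} {y₀ : E} {k : E → E} (hG : DifferentiableAt ℝ G y₀)
    (hl : ContinuousAt l y₀) (hsymm : ∀ y u v, G y u v = G y v u)
    (hinj : ∀ w, G y₀ w = 0 → l y₀ w = 0 → w = 0)
    (hrad : ∀ᶠ y in 𝓝 y₀, G y (k y) = 0) (hnorm : ∀ᶠ y in 𝓝 y₀, l y (k y) = 1) (v : E) :
    fderiv ℝ G y₀ v (k y₀) (k y₀) = 0 := by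
  have hk : Filter.Tendsto k (𝓝 y₀) (𝓝 (k y₀)) := by
    refine tendsto_of_apply_eq_of_injective (B := fun y => (G y).prod (l y)) (w := (0, 1)) ?_ ?_ ?_
      ?_
    · exact (ContinuousLinearMap.prodₗᵢ ℝ : ((E →L[ℝ] E →L[ℝ] ℝ) × (E →L[ℝ] ℝ)) ≃ₗᵢ[ℝ] _).continuous.continuousAt.comp
        (hG.continuousAt.prodMk hl)
    · refine (injective_iff_map_eq_zero _).2 fun w hw => ?_
      have hw' := Prod.ext_iff.1 hw
      exact hinj w hw'.1 hw'.2
    · filter_upwards [hrad, hnorm] with y h1 h2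
      simp [h1, h2]
    · simp [hrad.self_of_nhds, hnorm.self_of_nhds]
  have h0 : G y₀ (k y₀) = 0 := hrad.self_of_nhds
  have hq : HasFDerivAt (fun y => G y (k y₀) (k y₀))
      (((fderiv ℝ G y₀).flip (k y₀)).flip (k y₀)) y₀ := by
    have := (hG.hasFDerivAt.clm_apply (hasFDerivAt_const (k y₀) y₀)).clm_apply
      (hasFDerivAt_const (k y₀) y₀)
    refine this.congr_fderiv ?_
    ext u
    simp
  have hz : HasFDerivAt (fun y => G y (k y₀) (k y₀)) (0 : E →L[ℝ] ℝ) y₀ := by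
    rw [hasFDerivAt_iff_isLittleO]
    have hO : (fun y => ‖G y - G y₀‖) =O[𝓝 y₀] fun y => y - y₀ :=
      (hG.isBigO_sub (𝕜 := ℝ) (F := E →L[ℝ] E →L[ℝ] ℝ)).norm_left
    have ho : (fun y => k y₀ - k y) =o[𝓝 y₀] fun _ => (1 : ℝ) := by
      rw [Asymptotics.isLittleO_one_iff]
      simpa using hk.const_sub (k y₀)
    have hle : (fun y => G y (k y₀) (k y₀) - G y₀ (k y₀) (k y₀) - (0 : E →L[ℝ] ℝ) (y - y₀))
        =O[𝓝 y₀] fun y => ‖G y - G y₀‖ * ‖k y₀ - k y‖ := by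
      refine Asymptotics.IsBigO.of_bound ‖k y₀‖ ?_
      filter_upwards [hrad] with y hy
      have heq : G y (k y₀) (k y₀) - G y₀ (k y₀) (k y₀) - (0 : E →L[ℝ] ℝ) (y - y₀)
          = (G y - G y₀) (k y₀ - k y) (k y₀) := by
        have h1 : G y₀ (k y) (k y₀) = 0 := by rw [hsymm, h0]; rfl
        simp [hy, h0, h1]
      rw [heq]
      refine ((G y - G y₀).le_opNorm₂ _ _).trans (le_of_eq ?_)
      rw [Real.norm_eq_abs, abs_of_nonneg (by positivity)]
      ring
    refine hle.trans_isLittleO ?_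
    have := hO.norm_right.mul_isLittleO ho.norm_left
    simpa using this
  have := congrArg (fun A : E →L[ℝ] ℝ => A v) (hq.unique hz)
  simpa using this

end NormedSpace

section Coordinates

variable {E : Type*} [NormedAddCommGroup E] [NormedSpace ℝ E]
  {H : Type*} [TopologicalSpace H] {I : ModelWithCorners ℝ E H}
  {M : Type*} [TopologicalSpace M] [ChartedSpace H M]

theorem eventually_extChartAt_symm_mem (x₀ : M) :
    ∀ᶠ y in 𝓝[range I] (extChartAt I x₀ x₀), (extChartAt I x₀).symm y ∈ (chartAt H x₀).source := by
  filter_upwards [extChartAt_target_mem_nhdsWithin (I := I) x₀] with y hy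
  simpa using (extChartAt I x₀).map_target hy

variable [IsManifold I ∞ M]

theorem symmL_trivializationAt_eq_tangentCoordChange {x₀ x : M} (hx : x ∈ (chartAt H x₀).source) :
    (trivializationAt E (TangentSpace I) x₀).symmL ℝ x = tangentCoordChange I x₀ x x :=
  TangentBundle.symmL_trivializationAt_eq_core hx

theorem mfderiv_extChartAt_eq_tangentCoordChange {x₀ x : M} (hx : x ∈ (chartAt H x₀).source) :
    mfderiv I 𝓘(ℝ, E) (extChartAt I x₀) x = tangentCoordChange I x x₀ x := by
  rw [← TangentBundle.continuousLinearMapAt_trivializationAt hx]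
  exact TangentBundle.continuousLinearMapAt_trivializationAt_eq_core hx

theorem tangentCoordChange_tangentCoordChange {x₀ x : M} (hx : x ∈ (chartAt H x₀).source) (v : E) :
    tangentCoordChange I x x₀ x (tangentCoordChange I x₀ x x v) = v := by
  rw [tangentCoordChange_comp (by simpa using hx), tangentCoordChange_self (by simpa using hx)]

theorem tangentCoordChange_tangentCoordChange' {x₀ x : M} (hx : x ∈ (chartAt H x₀).source) (v : E) :
    tangentCoordChange I x₀ x x (tangentCoordChange I x x₀ x v) = v := by
  rw [tangentCoordChange_comp (by simpa using hx), tangentCoordChange_self (by simp)]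

theorem SmoothTensor2.contDiffWithinAt_tensorCoord {T : Tensor2 I M} (hT : SmoothTensor2 I T)
    (x₀ : M) :
    ContDiffWithinAt ℝ ∞ (tensorCoord I T x₀) (range I) (extChartAt I x₀ x₀) := by
  have h := (contMDiffAt_iff.1 ((contMDiffAt_hom_bundle _).1 (hT x₀)).2).2
  simp only [extChartAt_model_space_eq_id, PartialEquiv.refl_coe, Function.id_comp] at h
  have key : ∀ y, (extChartAt I x₀).symm y ∈ (chartAt H x₀).source →
      tensorCoord I T x₀ y = ContinuousLinearMap.inCoordinates E (TangentSpace I) (E →L[ℝ] ℝ)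
        (fun b : M => TangentSpace I b →L[ℝ] ℝ) x₀ ((extChartAt I x₀).symm y) x₀
        ((extChartAt I x₀).symm y) (T ((extChartAt I x₀).symm y)) := by
    intro y hy
    ext u v
    rw [inCoordinates_apply_eq₂ hy hy (mem_univ _)]
    simp only [Trivial.fiberBundle_trivializationAt', Trivial.linearMapAt_trivialization,
      LinearMap.id_coe, id_eq]
    rw [← Trivialization.symmL_apply (R := ℝ) _ hy, ← Trivialization.symmL_apply (R := ℝ) _ hy,
      symmL_trivializationAt_eq_tangentCoordChange hy]
    rfl
  refine h.congr_of_eventuallyEq ?_ ?_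
  · filter_upwards [eventually_extChartAt_symm_mem x₀] with y hy
    exact key y hy
  · exact key _ (by simp)

theorem SmoothOneForm.continuousWithinAt_coord {θ : OneForm I M} (hθ : SmoothOneForm I θ)
    (x₀ : M) :
    ContinuousWithinAt (fun y => ((θ ((extChartAt I x₀).symm y)).comp
      (tangentCoordChange I x₀ ((extChartAt I x₀).symm y) ((extChartAt I x₀).symm y)) : E →L[ℝ] ℝ))
      (range I) (extChartAt I x₀ x₀) := by
  have h := (contMDiffAt_iff.1 ((contMDiffAt_hom_bundle _).1 (hθ x₀)).2).2.continuousWithinAt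
  simp only [extChartAt_model_space_eq_id, PartialEquiv.refl_coe, Function.id_comp] at h
  have key : ∀ y, (extChartAt I x₀).symm y ∈ (chartAt H x₀).source →
      ((θ ((extChartAt I x₀).symm y)).comp
        (tangentCoordChange I x₀ ((extChartAt I x₀).symm y) ((extChartAt I x₀).symm y)) : E →L[ℝ] ℝ)
        = ContinuousLinearMap.inCoordinates E (TangentSpace I) ℝ
        (fun _ : M => ℝ) x₀ ((extChartAt I x₀).symm y) x₀
        ((extChartAt I x₀).symm y) (θ ((extChartAt I x₀).symm y)) := by
    intro y hy
    rw [← symmL_trivializationAt_eq_tangentCoordChange hy]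
    ext u
    simp [ContinuousLinearMap.inCoordinates]
    rfl
  refine h.congr_of_eventuallyEq ?_ ?_
  · filter_upwards [eventually_extChartAt_symm_mem x₀] with y hy
    exact key y hy
  · exact key _ (by simp)

end Coordinates

section LieForm

variable {E E' : Type*} [NormedAddCommGroup E] [NormedSpace ℝ E]
  [NormedAddCommGroup E'] [NormedSpace ℝ E']

/-- The pointwise expression of a pulled back Lie derivative: `G` is the derivative of the components
of the tensor, `B` the tensor, `A` the differential of the map, `c` the vector and `K` the derivative
of its components. -/
def lieForm (G : E' →L[ℝ] E' →L[ℝ] E' →L[ℝ] ℝ) (B : E' →L[ℝ] E' →L[ℝ] ℝ) (A : E →L[ℝ] E')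
    (c : E') (K : E →L[ℝ] E') (u v : E) : ℝ :=
  G c (A u) (A v) + B (K u) (A v) + B (A u) (K v)

set_option synthInstance.maxHeartbeats 200000 in
theorem lieForm_add (G : E' →L[ℝ] E' →L[ℝ] E' →L[ℝ] ℝ) (B : E' →L[ℝ] E' →L[ℝ] ℝ)
    (A : E →L[ℝ] E') (c c' : E') (K K' : E →L[ℝ] E') (u v : E) :
    lieForm G B A (c + c') (K + K') u v = lieForm G B A c K u v + lieForm G B A c' K' u v := by
  simp only [lieForm, map_add, add_apply]
  ring

set_option synthInstance.maxHeartbeats 200000 in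
theorem lieForm_smul (G : E' →L[ℝ] E' →L[ℝ] E' →L[ℝ] ℝ) (B : E' →L[ℝ] E' →L[ℝ] ℝ)
    (A : E →L[ℝ] E') (a : ℝ) (θ : E →L[ℝ] ℝ) (c : E') (K : E →L[ℝ] E') (u v : E) :
    lieForm G B A (a • c) (a • K + θ.smulRight c) u v
      = a * lieForm G B A c K u v + θ u * B c (A v) + θ v * B (A u) c := by
  simp only [lieForm, map_add, map_smul, add_apply, smul_apply, ContinuousLinearMap.smulRight_apply,
    smul_eq_mul]
  ring

set_option synthInstance.maxHeartbeats 200000 in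
theorem lieForm_pullback {C : E' → E' →L[ℝ] E' →L[ℝ] ℝ} {S : E → E →L[ℝ] E →L[ℝ] ℝ} {F : E → E'}
    {s : Set E'} {y₀ : E} {V : E} {K : E →L[ℝ] E} {u v : E} (hF : DifferentiableAt ℝ F y₀)
    (hF' : DifferentiableAt ℝ (fderiv ℝ F) y₀) (hsymm : IsSymmSndFDerivAt ℝ F y₀)
    (hFs : ∀ᶠ y in 𝓝 y₀, F y ∈ s) (hC : DifferentiableWithinAt ℝ C s (F y₀))
    (hS : DifferentiableAt ℝ S y₀)
    (hpull : ∀ᶠ y in 𝓝 y₀, ∀ u v, S y u v = C (F y) (fderiv ℝ F y u) (fderiv ℝ F y v)) :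
    lieForm (fderivWithin ℝ C s (F y₀)) (C (F y₀)) (fderiv ℝ F y₀) (fderiv ℝ F y₀ V)
        ((fderiv ℝ F y₀).comp K + (fderiv ℝ (fderiv ℝ F) y₀).flip V) u v
      = lieForm (fderiv ℝ S y₀) (S y₀) (ContinuousLinearMap.id ℝ E) V K u v := by
  have h1 := (hS.hasFDerivAt.clm_apply (hasFDerivAt_const u y₀)).clm_apply (hasFDerivAt_const v y₀)
  have hCF : HasFDerivAt (fun y => C (F y))
      ((fderivWithin ℝ C s (F y₀)).comp (fderiv ℝ F y₀)) y₀ :=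
    hC.hasFDerivWithinAt.comp_hasFDerivAt (𝕜 := ℝ) (G := E' →L[ℝ] E' →L[ℝ] ℝ) y₀ hF.hasFDerivAt hFs
  have hFu := hF'.hasFDerivAt.clm_apply (hasFDerivAt_const u y₀)
  have hFv := hF'.hasFDerivAt.clm_apply (hasFDerivAt_const v y₀)
  have h2 := (hCF.clm_apply hFu).clm_apply hFv
  have h3 := congrArg (fun A : E →L[ℝ] ℝ => A V)
    (h1.unique (h2.congr_of_eventuallyEq (hpull.mono fun y hy => hy u v)))
  have h4 := hpull.self_of_nhds
  simp at h3
  simp only [lieForm, h4, add_apply, map_add, ContinuousLinearMap.comp_apply,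
    ContinuousLinearMap.flip_apply, ContinuousLinearMap.id_apply, h3, hsymm u V, hsymm v V]
  ring

end LieForm

section LieDerivAlong

variable {E : Type*} [NormedAddCommGroup E] [NormedSpace ℝ E]
  {H : Type*} [TopologicalSpace H] {I : ModelWithCorners ℝ E H}
  {M : Type*} [TopologicalSpace M] [ChartedSpace H M]
  {E' : Type*} [NormedAddCommGroup E'] [NormedSpace ℝ E']
  {H' : Type*} [TopologicalSpace H'] {I' : ModelWithCorners ℝ E' H'}
  {M' : Type*} [TopologicalSpace M'] [ChartedSpace H' M'] [IsManifold I' ∞ M']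

theorem lieDerivAlong_apply {T : Tensor2 I' M'} {f : M → M'} {ζ : ∀ x : M, TangentSpace I' (f x)}
    {x : M} {K : E →L[ℝ] E'} (hK : HasMFDerivAt I 𝓘(ℝ, E') (vectorCoord I' f ζ (f x)) x K)
    (u v : TangentSpace I x) :
    lieDerivAlong I I' T f ζ x u v
      = lieForm (E := E) (fderivWithin ℝ (tensorCoord I' T (f x)) (range I') (extChartAt I' (f x) (f x)))
        (T (f x)) (mfderiv I I' f x) (ζ x) K u v := by
  rw [← hK.mfderiv]
  rfl

theorem lieDeriv_apply {T : Tensor2 I' M'} {Z : VField I' M'} {x : M'} {K : E' →L[ℝ] E'}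
    (hK : HasMFDerivAt I' 𝓘(ℝ, E') (vectorCoord I' (fun q : M' => q) Z x) x K)
    (u v : TangentSpace I' x) :
    lieDeriv I' T Z x u v
      = lieForm (E := E') (fderivWithin ℝ (tensorCoord I' T x) (range I') (extChartAt I' x x))
        (T x) (ContinuousLinearMap.id ℝ E') (Z x) K u v := by
  rw [← hK.mfderiv]
  rfl

theorem HasMFDerivAt.vectorCoord_add {f : M → M'} {ζ η : ∀ x : M, TangentSpace I' (f x)}
    {x₀ : M'} {x : M} {K L : E →L[ℝ] E'}
    (hζ : HasMFDerivAt I 𝓘(ℝ, E') (vectorCoord I' f ζ x₀) x K)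
    (hη : HasMFDerivAt I 𝓘(ℝ, E') (vectorCoord I' f η x₀) x L) :
    HasMFDerivAt I 𝓘(ℝ, E') (vectorCoord I' f (fun q => ζ q + η q) x₀) x (K + L) := by
  have heq : vectorCoord I' f (fun q => ζ q + η q) x₀
      = vectorCoord I' f ζ x₀ + vectorCoord I' f η x₀ :=
    funext fun q => map_add (tangentCoordChange I' (f q) x₀ (f q)) (ζ q : E') (η q : E')
  rw [heq]
  exact hζ.add hη

theorem HasMFDerivAt.vectorCoord_smul {f : M → M'} {ζ : ∀ x : M, TangentSpace I' (f x)}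
    {z : M → ℝ} {x : M} {K : E →L[ℝ] E'} {θ : E →L[ℝ] ℝ} {c : E'}
    (hζ : HasMFDerivAt I 𝓘(ℝ, E') (vectorCoord I' f ζ (f x)) x K)
    (hz : HasMFDerivAt I 𝓘(ℝ, ℝ) z x θ) (hc : ζ x = c) :
    HasMFDerivAt I 𝓘(ℝ, E') (vectorCoord I' f (fun q => z q • ζ q) (f x)) x
      (z x • K + θ.smulRight c) := by
  have heq : vectorCoord I' f (fun q => z q • ζ q) (f x)
      = fun q => z q • vectorCoord I' f ζ (f x) q :=
    funext fun q => map_smul (tangentCoordChange I' (f q) (f x) (f q)) (z q) (ζ q : E')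
  have hself : vectorCoord I' f ζ (f x) x = c := by
    rw [← hc]
    exact tangentCoordChange_self (by simp)
  rw [heq]
  refine ⟨hz.1.smul hζ.1, ?_⟩
  have := hz.2.fun_smul hζ.2
  simp only [writtenInExtChartAt, extChartAt_model_space_eq_id, PartialEquiv.refl_coe,
    Function.comp_def, id_eq, extChartAt_to_inv, hself] at this ⊢
  exact this

theorem lieDerivAlong_add_apply {T : Tensor2 I' M'} {f : M → M'}
    {ζ η : ∀ x : M, TangentSpace I' (f x)}
    {x : M} (hζ : MDifferentiableAt I 𝓘(ℝ, E') (vectorCoord I' f ζ (f x)) x)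
    (hη : MDifferentiableAt I 𝓘(ℝ, E') (vectorCoord I' f η (f x)) x) (u v : TangentSpace I x) :
    lieDerivAlong I I' T f (fun q => ζ q + η q) x u v
      = lieDerivAlong I I' T f ζ x u v + lieDerivAlong I I' T f η x u v := by
  rw [lieDerivAlong_apply (HasMFDerivAt.vectorCoord_add hζ.hasMFDerivAt hη.hasMFDerivAt),
    lieDerivAlong_apply hζ.hasMFDerivAt, lieDerivAlong_apply hη.hasMFDerivAt]
  exact lieForm_add ..

theorem lieDerivAlong_smul_apply {T : Tensor2 I' M'} {f : M → M'}
    {ζ : ∀ x : M, TangentSpace I' (f x)} {z : M → ℝ}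
    {x : M} (hζ : MDifferentiableAt I 𝓘(ℝ, E') (vectorCoord I' f ζ (f x)) x)
    (hz : MDifferentiableAt I 𝓘(ℝ, ℝ) z x) (u v : TangentSpace I x) :
    lieDerivAlong I I' T f (fun q => z q • ζ q) x u v
      = z x * lieDerivAlong I I' T f ζ x u v
        + dScalar I z x u * T (f x) (ζ x) (mfderiv I I' f x v)
        + dScalar I z x v * T (f x) (mfderiv I I' f x u) (ζ x) := by
  rw [lieDerivAlong_apply (HasMFDerivAt.vectorCoord_smul hζ.hasMFDerivAt hz.hasMFDerivAt rfl),
    lieDerivAlong_apply hζ.hasMFDerivAt]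
  exact lieForm_smul ..

end LieDerivAlong

section Naturality

variable {E : Type*} [NormedAddCommGroup E] [NormedSpace ℝ E]
  {H : Type*} [TopologicalSpace H] {I : ModelWithCorners ℝ E H} [I.Boundaryless]
  {M : Type*} [TopologicalSpace M] [ChartedSpace H M]
  {E' : Type*} [NormedAddCommGroup E'] [NormedSpace ℝ E']
  {H' : Type*} [TopologicalSpace H'] {I' : ModelWithCorners ℝ E' H'}
  {M' : Type*} [TopologicalSpace M'] [ChartedSpace H' M']

theorem contDiffAt_writtenInExtChartAt {f : M → M'} {x : M} (hf : ContMDiffAt I I' ∞ f x) :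
    ContDiffAt ℝ ∞ (writtenInExtChartAt I I' x f) (extChartAt I x x) := by
  have := (contMDiffAt_iff.1 hf).2
  rwa [I.range_eq_univ, contDiffWithinAt_univ] at this

theorem hasMFDerivAt_iff_hasFDerivAt_comp_symm {h : M → E'} {x : M} {K : E →L[ℝ] E'} :
    HasMFDerivAt I 𝓘(ℝ, E') h x K ↔
      ContinuousAt h x ∧ HasFDerivAt (h ∘ (extChartAt I x).symm) K (extChartAt I x x) := by
  rw [← hasFDerivWithinAt_univ, ← I.range_eq_univ]
  rfl

theorem eventually_extChartAt_symm_nhds {f : M → M'} {x : M} (hf : ContinuousAt f x) :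
    ∀ᶠ y in 𝓝 (extChartAt I x x), y ∈ (extChartAt I x).target ∧
      (extChartAt I x).symm y ∈ (chartAt H x).source ∧
      f ((extChartAt I x).symm y) ∈ (chartAt H' (f x)).source := by
  have h1 : ∀ᶠ q in 𝓝 x, f q ∈ (chartAt H' (f x)).source :=
    hf ((chartAt H' (f x)).open_source.mem_nhds (mem_chart_source H' (f x)))
  have h2 : ContinuousAt (extChartAt I x).symm (extChartAt I x x) := continuousAt_extChartAt_symm x
  have h3 : (extChartAt I x).symm (extChartAt I x x) = x := by simp
  rw [ContinuousAt, h3] at h2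
  filter_upwards [h2.eventually h1, extChartAt_target_mem_nhds (I := I) x] with y hy hy'
  exact ⟨hy', by simpa using (extChartAt I x).map_target hy', hy⟩

variable [IsManifold I ∞ M] [IsManifold I' ∞ M']

/-- The differential of `f` in the preferred charts at `x` and `f x`. -/
theorem tangentCoordChange_mfderiv {f : M → M'} {x q : M} (hf : MDifferentiableAt I I' f q)
    (hq : q ∈ (chartAt H x).source) (hfq : f q ∈ (chartAt H' (f x)).source)
    (v : TangentSpace I q) :
    tangentCoordChange I' (f q) (f x) (f q) (mfderiv I I' f q v)
      = fderiv ℝ (writtenInExtChartAt I I' x f) (extChartAt I x q)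
          (tangentCoordChange I q x q v) := by
  have h1 : (writtenInExtChartAt I I' x f) ∘ extChartAt I x =ᶠ[𝓝 q] extChartAt I' (f x) ∘ f := by
    filter_upwards [(chartAt H x).open_source.mem_nhds hq] with y hy
    simp only [writtenInExtChartAt, Function.comp_apply]
    rw [(extChartAt I x).left_inv (by simpa using hy)]
  have hF : MDifferentiableAt 𝓘(ℝ, E) 𝓘(ℝ, E') (writtenInExtChartAt I I' x f) (extChartAt I x q) := by
    have hq' : q ∈ (extChartAt I x).source := by simpa using hq
    have hsymm : MDifferentiableAt 𝓘(ℝ, E) I (extChartAt I x).symm (extChartAt I x q) := by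
      have := mdifferentiableWithinAt_extChartAt_symm (I := I) ((extChartAt I x).map_source hq')
      rwa [I.range_eq_univ, mdifferentiableWithinAt_univ] at this
    have hinv := (extChartAt I x).left_inv hq'
    refine MDifferentiableAt.comp (I' := I') _ ?_ (MDifferentiableAt.comp (I' := I) _ ?_ hsymm)
    · simp only [Function.comp_apply, hinv]
      exact mdifferentiableAt_extChartAt hfq
    · rwa [hinv]
  have h2 := mfderiv_comp q hF (mdifferentiableAt_extChartAt hq)
  have h3 := mfderiv_comp q (mdifferentiableAt_extChartAt hfq) hf
  rw [h1.mfderiv_eq] at h2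
  have h4 := h3.symm.trans h2
  rw [mfderiv_extChartAt_eq_tangentCoordChange hq, mfderiv_extChartAt_eq_tangentCoordChange hfq,
    mfderiv_eq_fderiv] at h4
  exact congrArg (fun A : E →L[ℝ] E' => A v) h4

omit [I.Boundaryless] in
theorem tensorCoord_self (T : Tensor2 I M) (x : M) :
    tensorCoord I T x (extChartAt I x x) = T x := by
  have hx : (extChartAt I x).symm (extChartAt I x x) = x := by simp
  ext u v
  change T ((extChartAt I x).symm (extChartAt I x x)) (tangentCoordChange I x _ _ u)
    (tangentCoordChange I x _ _ v) = _
  rw [hx]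
  have hs : ∀ w : E, tangentCoordChange I x x x w = w :=
    fun w => tangentCoordChange_self (by simp)
  rw [hs, hs]
  rfl

theorem fderiv_writtenInExtChartAt_self {f : M → M'} {x : M} (hf : MDifferentiableAt I I' f x) :
    fderiv ℝ (writtenInExtChartAt I I' x f) (extChartAt I x x) = mfderiv I I' f x := by
  ext v
  have := tangentCoordChange_mfderiv hf (mem_chart_source H x) (mem_chart_source H' (f x)) v
  rw [tangentCoordChange_self (v := v) (by simp)] at this
  exact this.symm.trans (tangentCoordChange_self (by simp))

/-- The components of a push-forward `f_* V` along `f`. -/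
theorem hasMFDerivAt_vectorCoord_mfderiv {f : M → M'} (hf : ContMDiff I I' ∞ f) {V : VField I M}
    {x : M} {K : E →L[ℝ] E}
    (hV : HasMFDerivAt I 𝓘(ℝ, E) (vectorCoord I (fun q : M => q) V x) x K) :
    HasMFDerivAt I 𝓘(ℝ, E') (vectorCoord I' f (fun q => mfderiv I I' f q (V q)) (f x)) x
      ((fderiv ℝ (writtenInExtChartAt I I' x f) (extChartAt I x x)).comp K
        + (fderiv ℝ (fderiv ℝ (writtenInExtChartAt I I' x f)) (extChartAt I x x)).flip
          (V x)) := by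
  set F := writtenInExtChartAt I I' x f
  have hF : ContDiffAt ℝ ∞ F (extChartAt I x x) := contDiffAt_writtenInExtChartAt (hf x)
  have hF' : DifferentiableAt ℝ (fderiv ℝ F) (extChartAt I x x) :=
    (hF.fderiv_right (m := 1) (by norm_cast)).differentiableAt (by norm_num)
  have hdf : MDifferentiable I I' f := hf.mdifferentiable (by simp)
  have heq : vectorCoord I' f (fun q => mfderiv I I' f q (V q)) (f x)
      =ᶠ[𝓝 x] fun q => fderiv ℝ F (extChartAt I x q) (vectorCoord I (fun q : M => q) V x q) := by
    have h1 : ∀ᶠ q in 𝓝 x, f q ∈ (chartAt H' (f x)).source :=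
      (hf x).continuousAt ((chartAt H' (f x)).open_source.mem_nhds (mem_chart_source H' (f x)))
    filter_upwards [h1, (chartAt H x).open_source.mem_nhds (mem_chart_source H x)] with q hfq hq
    exact tangentCoordChange_mfderiv (hdf q) hq hfq (V q)
  refine HasMFDerivAt.congr_of_eventuallyEq ?_ heq
  obtain ⟨hc, hd⟩ := hasMFDerivAt_iff_hasFDerivAt_comp_symm.1 hV
  refine hasMFDerivAt_iff_hasFDerivAt_comp_symm.2 ⟨?_, ?_⟩
  · exact (hF'.continuousAt.comp (continuousAt_extChartAt x)).clm_apply hc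
  · have h2 := hF'.hasFDerivAt.clm_apply hd
    have hself : vectorCoord I (fun q : M => q) V x x = V x := tangentCoordChange_self (by simp)
    simp only [Function.comp_apply, extChartAt_to_inv, hself] at h2
    refine h2.congr_of_eventuallyEq ?_
    filter_upwards [extChartAt_target_mem_nhds (I := I) x] with y hy
    simp only [Function.comp_apply]
    rw [(extChartAt I x).right_inv hy]

theorem tensorCoord_pullTensor2 (T : Tensor2 I' M') {f : M → M'} (hf : MDifferentiable I I' f)
    {x : M} {y : E}
    (hy : y ∈ (extChartAt I x).target ∧ (extChartAt I x).symm y ∈ (chartAt H x).source ∧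
      f ((extChartAt I x).symm y) ∈ (chartAt H' (f x)).source) (u v : E) :
    tensorCoord I (pullTensor2 I I' T f) x y u v
      = tensorCoord I' T (f x) (writtenInExtChartAt I I' x f y)
        (fderiv ℝ (writtenInExtChartAt I I' x f) y u)
        (fderiv ℝ (writtenInExtChartAt I I' x f) y v) := by
  obtain ⟨h1, h2, h3⟩ := hy
  have hinv : (extChartAt I' (f x)).symm (writtenInExtChartAt I I' x f y)
      = f ((extChartAt I x).symm y) := by
    simp only [writtenInExtChartAt, Function.comp_apply]
    exact (extChartAt I' (f x)).left_inv (by simpa using h3)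
  have key : ∀ w : E, tangentCoordChange I' (f x) (f ((extChartAt I x).symm y))
      (f ((extChartAt I x).symm y)) (fderiv ℝ (writtenInExtChartAt I I' x f) y w)
      = mfderiv I I' f ((extChartAt I x).symm y)
        (tangentCoordChange I x ((extChartAt I x).symm y) ((extChartAt I x).symm y) w) := by
    intro w
    have h4 := tangentCoordChange_mfderiv (hf ((extChartAt I x).symm y)) h2 h3
      (tangentCoordChange I x ((extChartAt I x).symm y) ((extChartAt I x).symm y) w)
    rw [tangentCoordChange_tangentCoordChange h2, (extChartAt I x).right_inv h1] at h4
    rw [← h4]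
    exact tangentCoordChange_tangentCoordChange' h3 _
  change _ = (T ((extChartAt I' (f x)).symm (writtenInExtChartAt I I' x f y)))
    (tangentCoordChange I' (f x) _ _ _) (tangentCoordChange I' (f x) _ _ _)
  rw [hinv, key, key]
  rfl

set_option synthInstance.maxHeartbeats 200000 in
/-- Naturality of the Lie derivative: along `f`, the Lie derivative of `T` in the direction of a
tangential field `f_* V` is the Lie derivative of `f^* T` in the direction of `V`. -/
theorem lieDerivAlong_mfderiv {T : Tensor2 I' M'} {f : M → M'} (hf : ContMDiff I I' ∞ f)
    {V : VField I M} {x : M}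
    (hT : DifferentiableWithinAt ℝ (tensorCoord I' T (f x)) (range I')
      (extChartAt I' (f x) (f x)))
    (hS : DifferentiableAt ℝ (tensorCoord I (pullTensor2 I I' T f) x) (extChartAt I x x))
    (hV : MDifferentiableAt I 𝓘(ℝ, E) (vectorCoord I (fun q : M => q) V x) x)
    (u v : TangentSpace I x) :
    lieDerivAlong I I' T f (fun q => mfderiv I I' f q (V q)) x u v
      = lieDeriv I (pullTensor2 I I' T f) V x u v := by
  have hdf : MDifferentiable I I' f := hf.mdifferentiable (by simp)
  obtain ⟨K, hK⟩ : ∃ K : E →L[ℝ] E,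
      HasMFDerivAt I 𝓘(ℝ, E) (vectorCoord I (fun q : M => q) V x) x K := ⟨_, hV.hasMFDerivAt⟩
  rw [lieDerivAlong_apply (hasMFDerivAt_vectorCoord_mfderiv hf hK), lieDeriv_apply hK]
  rw [I.range_eq_univ, fderivWithin_univ]
  have hF : ContDiffAt ℝ ∞ (writtenInExtChartAt I I' x f) (extChartAt I x x) :=
    contDiffAt_writtenInExtChartAt (hf x)
  have hF' : DifferentiableAt ℝ (fderiv ℝ (writtenInExtChartAt I I' x f)) (extChartAt I x x) :=
    (hF.fderiv_right (m := 1) (by norm_cast)).differentiableAt (by norm_num)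
  have hsymm : IsSymmSndFDerivAt ℝ (writtenInExtChartAt I I' x f) (extChartAt I x x) :=
    hF.isSymmSndFDerivAt (by
      simp only [minSmoothness_of_isRCLikeNormedField]
      exact ENat.LEInfty.out)
  have hF0 : writtenInExtChartAt I I' x f (extChartAt I x x) = extChartAt I' (f x) (f x) := by simp
  have key := lieForm_pullback (E := E) (E' := E') (s := range I') (V := (V x : E)) (K := K) (u := u) (v := v)
    (hF.differentiableAt (by simp)) hF' hsymm
    (.of_forall fun y => mem_range_self _)
    (hF0 ▸ hT) hS ((eventually_extChartAt_symm_nhds (hf x).continuousAt).mono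
      fun y hy u v => tensorCoord_pullTensor2 T hdf hy u v)
  rw [hF0, tensorCoord_self, tensorCoord_self] at key
  rw [← fderiv_writtenInExtChartAt_self (hdf x)]
  exact key

end Naturality

section NullData

variable {n : ℕ} {N : Type*} [TopologicalSpace N] [ChartedSpace (EuclideanSpace ℝ (Fin n)) N]
  [IsManifold (𝓡 n) ∞ N] {D : HypersurfaceData n N}

theorem IsHypersurfaceData.eq_zero (hD : IsHypersurfaceData D) {p : N} {w : TangentSpace (𝓡 n) p}
    (h1 : D.γ p w = 0) (h2 : D.ell p w = 0) : w = 0 :=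
  congrArg Prod.fst (hD.nondegenerate p (w, 0) fun w' => by
    simp [HypersurfaceData.ambient, h1, h2])

theorem IsNullHypersurfaceData.isNormalPair_normal (hD : IsNullHypersurfaceData D) (p : N) :
    D.IsNormalPair p (D.normal p, 0) := by
  rw [← hD.null p]
  exact hD.isNormalPair_normalPair p

theorem IsNullHypersurfaceData.γ_normal (hD : IsNullHypersurfaceData D) (p : N) :
    D.γ p (D.normal p) = 0 := by
  ext w
  simpa using (hD.isNormalPair_normal p).1 w

theorem IsNullHypersurfaceData.ell_normal (hD : IsNullHypersurfaceData D) (p : N) :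
    D.ell p (D.normal p) = 1 := by
  simpa using (hD.isNormalPair_normal p).2

theorem IsNullHypersurfaceData.eq_normal (hD : IsNullHypersurfaceData D) {p : N}
    {w : TangentSpace (𝓡 n) p} (h1 : D.γ p w = 0) (h2 : D.ell p w = 1) : w = D.normal p :=
  congrArg Prod.fst ((hD.existsUnique_isNormalPair p).unique (y₁ := (w, 0)) (y₂ := (D.normal p, 0))
    ⟨fun Z => by simp [h1], by simp [h2]⟩ (hD.isNormalPair_normal p))

/-- On null hypersurface data `(£_W γ)(n, n) = 0`. -/
theorem IsNullHypersurfaceData.lieDeriv_γ_normal (hD : IsNullHypersurfaceData D)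
    (W : VField (𝓡 n) N) (p : N) :
    lieDeriv (𝓡 n) D.γ W p (D.normal p) (D.normal p) = 0 := by
  have hq : ∀ᶠ y in 𝓝 (extChartAt (𝓡 n) p p),
      (extChartAt (𝓡 n) p).symm y ∈ (chartAt (EuclideanSpace ℝ (Fin n)) p).source := by
    have := eventually_extChartAt_symm_mem (I := 𝓡 n) p
    rwa [(𝓡 n).range_eq_univ, nhdsWithin_univ] at this
  have hG : DifferentiableAt ℝ (tensorCoord (𝓡 n) D.γ p) (extChartAt (𝓡 n) p p) := by
    have := hD.smooth_γ.contDiffWithinAt_tensorCoord p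
    rw [(𝓡 n).range_eq_univ, contDiffWithinAt_univ] at this
    exact this.differentiableAt (by simp)
  have hl := hD.smooth_ell.continuousWithinAt_coord p
  rw [(𝓡 n).range_eq_univ, continuousWithinAt_univ] at hl
  let k : EuclideanSpace ℝ (Fin n) → EuclideanSpace ℝ (Fin n) := fun y =>
    tangentCoordChange (𝓡 n) ((extChartAt (𝓡 n) p).symm y) p ((extChartAt (𝓡 n) p).symm y)
      (D.normal ((extChartAt (𝓡 n) p).symm y))
  have hk : k (extChartAt (𝓡 n) p p) = D.normal p := by
    have : ∀ q, q = p → tangentCoordChange (𝓡 n) q p q (D.normal q) = D.normal p := by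
      rintro q rfl
      exact tangentCoordChange_self (by simp)
    exact this _ (by simp)
  have hkq : ∀ y, (extChartAt (𝓡 n) p).symm y ∈ (chartAt (EuclideanSpace ℝ (Fin n)) p).source →
      tangentCoordChange (𝓡 n) p ((extChartAt (𝓡 n) p).symm y) ((extChartAt (𝓡 n) p).symm y) (k y)
        = D.normal ((extChartAt (𝓡 n) p).symm y) := fun y hy =>
    tangentCoordChange_tangentCoordChange' hy _
  have hself : tensorCoord (𝓡 n) D.γ p (extChartAt (𝓡 n) p p) = D.γ p := tensorCoord_self _ _
  have key := fderiv_radical_eq_zero (k := k) hG hl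
    (fun y u v => hD.symm_γ _ _ _)
    (fun w h1 h2 => by
      rw [hself] at h1
      have h3 : D.ell p w = 0 := by
        rw [← h2]
        have : ∀ q, q = p → D.ell p w = D.ell q (tangentCoordChange (𝓡 n) p q q w) := by
          rintro q rfl
          have hs : tangentCoordChange (𝓡 n) q q q w = w := tangentCoordChange_self (by simp)
          exact congrArg (fun v : EuclideanSpace ℝ (Fin n) => D.ell q v) hs.symm
        exact this _ (by simp)
      exact hD.eq_zero h1 h3)
    (hq.mono fun y hy => by
      ext v
      change D.γ ((extChartAt (𝓡 n) p).symm y) (tangentCoordChange (𝓡 n) p _ _ (k y)) _ = 0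
      rw [hkq y hy, hD.γ_normal]
      rfl)
    (hq.mono fun y hy => by
      change D.ell ((extChartAt (𝓡 n) p).symm y) (tangentCoordChange (𝓡 n) p _ _ (k y)) = 1
      rw [hkq y hy, hD.ell_normal])
    (W p)
  rw [hk] at key
  have hK : ∀ w : TangentSpace (𝓡 n) p, D.γ p w (D.normal p) = 0 := fun w => by
    rw [hD.symm_γ, hD.γ_normal]
    rfl
  have h0 : ∀ w : TangentSpace (𝓡 n) p, D.γ p (D.normal p) w = 0 := fun w => by
    rw [hD.γ_normal]
    rfl
  rw [← fderivWithin_univ, ← (𝓡 n).range_eq_univ] at key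
  have hsum : ∀ {a b c : ℝ}, a = 0 → b = 0 → c = 0 → a + b + c = 0 := by
    rintro a b c rfl rfl rfl
    simp
  exact hsum key (hK _) (h0 _)

variable {D' : HypersurfaceData n N} {φ : Diffeomorph (𝓡 n) (𝓡 n) N N ∞} {z : N → ℝ}
  {V : VField (𝓡 n) N}

theorem IsMatchingGauge.γ_pullback (h : IsMatchingGauge D D' φ z V) : (D'.pullback φ).γ = D.γ :=
  h.γ_eq

/-- On vectors in the radical of `γ` the one-forms `z φ^* ℓ'` and `ℓ` agree. -/
theorem IsMatchingGauge.mul_ell_pullback (h : IsMatchingGauge D D' φ z V)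
    (hD : IsNullHypersurfaceData D) {p : N} {w : TangentSpace (𝓡 n) p} (hw : D.γ p w = 0) :
    z p * (D'.pullback φ).ell p w = D.ell p w := by
  rw [← h.ell_eq]
  have h1 : (D'.pullback φ).γ p (V p) w = 0 := by
    rw [h.γ_pullback, hD.symm_γ, hw]
    rfl
  simp [HypersurfaceData.gauge, h1]

theorem IsMatchingGauge.ell_pullback_normal (h : IsMatchingGauge D D' φ z V)
    (hD : IsNullHypersurfaceData D) (p : N) : (D'.pullback φ).ell p (D.normal p) = 1 / z p := by
  have := h.mul_ell_pullback hD (hD.γ_normal p)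
  rw [hD.ell_normal] at this
  field_simp [h.z_ne_zero p]
  linarith

/-- The field `n` of the gauge transformed data does not depend on the gauge vector. -/
theorem IsMatchingGauge.normal_gauge (h : IsMatchingGauge D D' φ z V)
    (hD : IsNullHypersurfaceData D) (U : VField (𝓡 n) N) (p : N) :
    ((D'.pullback φ).gauge z U).normal p = D.normal p := by
  set G := (D'.pullback φ).gauge z U with hGdef
  have hγ : G.γ = D.γ := h.γ_eq
  have hell : ∀ w, D.γ p w = 0 → G.ell p w = D.ell p w := fun w hw => by
    have h1 : (D'.pullback φ).γ p (U p) w = 0 := by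
      rw [h.γ_pullback, hD.symm_γ, hw]
      rfl
    rw [← h.mul_ell_pullback hD hw]
    simp [hGdef, HypersurfaceData.gauge, h1]
  have hex : ∃ w, G.IsNormalPair p w := ⟨(D.normal p, 0), fun Z => by simp [hγ, hD.γ_normal],
    by simp [hell _ (hD.γ_normal p), hD.ell_normal]⟩
  have hw : G.IsNormalPair p (G.normalPair p) := Classical.epsilon_spec hex
  have h2 : (G.normalPair p).2 = 0 := by
    have := hw.1 (D.normal p)
    rw [hell _ (hD.γ_normal p), hD.ell_normal, hγ, hD.symm_γ, hD.γ_normal] at this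
    simpa using this
  have h1 : D.γ p (G.normalPair p).1 = 0 := by
    ext Z
    simpa [h2, hγ] using hw.1 Z
  refine hD.eq_normal h1 ?_
  exact (hell _ h1).symm.trans (by simpa [h2] using hw.2)

theorem IsMatchingGauge.mfderiv_normal (h : IsMatchingGauge D D' φ z V)
    (hD : IsNullHypersurfaceData D) (hD' : IsNullHypersurfaceData D') (p : N) :
    z p • mfderiv (𝓡 n) (𝓡 n) φ p (D.normal p) = D'.normal (φ p) := by
  refine hD'.eq_normal ?_ ?_
  · ext Z
    obtain ⟨Z', rfl⟩ : ∃ Z', mfderiv (𝓡 n) (𝓡 n) φ p Z' = Z :=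
      (φ.mfderivToContinuousLinearEquiv (by simp) p).surjective Z
    have h1 : D'.γ (φ p) (mfderiv (𝓡 n) (𝓡 n) φ p (D.normal p)) (mfderiv (𝓡 n) (𝓡 n) φ p Z')
        = D.γ p (D.normal p) Z' := by
      rw [← h.γ_pullback]
      rfl
    simp [h1, hD.γ_normal]
  · have h1 : D'.ell (φ p) (mfderiv (𝓡 n) (𝓡 n) φ p (D.normal p)) = 1 / z p :=
      h.ell_pullback_normal hD p
    rw [map_smul, h1, smul_eq_mul, mul_one_div_cancel (h.z_ne_zero p)]

set_option synthInstance.maxHeartbeats 200000 in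
theorem IsMatchingGauge.surfaceGravity_gauge (h : IsMatchingGauge D D' φ z V)
    (hD : IsNullHypersurfaceData D) (U : VField (𝓡 n) N) (p : N) :
    ((D'.pullback φ).gauge z U).surfaceGravity p
      = -(z p * (D'.pullback φ).Y p (D.normal p) (D.normal p)
          + 1 / z p * dScalar (𝓡 n) z p (D.normal p)) := by
  have h1 := hD.lieDeriv_γ_normal (fun q => z q • U q) p
  rw [← h.γ_pullback] at h1
  rw [HypersurfaceData.surfaceGravity, h.normal_gauge hD, ← h.ell_pullback_normal hD p]
  simp [HypersurfaceData.gauge, h1, symProd]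
  ring

theorem IsMatchingGauge.pushSurfaceGravity_eq (h : IsMatchingGauge D D' φ z V)
    (hD : IsNullHypersurfaceData D) (hD' : IsNullHypersurfaceData D') (p : N) :
    pushSurfaceGravity D D' φ z p
      = -(z p * (D'.pullback φ).Y p (D.normal p) (D.normal p)
          + 1 / z p * dScalar (𝓡 n) z p (D.normal p)) := by
  have hz := h.z_ne_zero p
  have h1 : (D'.pullback φ).Y p (D.normal p) (D.normal p)
      = D'.Y (φ p) (mfderiv (𝓡 n) (𝓡 n) φ p (D.normal p))
        (mfderiv (𝓡 n) (𝓡 n) φ p (D.normal p)) := rfl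
  rw [pushSurfaceGravity, HypersurfaceData.surfaceGravity, ← h.mfderiv_normal hD hD', h1]
  simp only [map_smul, smul_apply, smul_eq_mul]
  field_simp
  ring

end NullData

section Matching

variable {n : ℕ} {N : Type*} [TopologicalSpace N] [ChartedSpace (EuclideanSpace ℝ (Fin n)) N]
  [IsManifold (𝓡 n) ∞ N]
  {M : Type*} [TopologicalSpace M] [ChartedSpace (EuclideanHalfSpace (n + 1)) M]
  [IsManifold (𝓡∂ (n + 1)) ∞ M]
  {D D' : HypersurfaceData n N} {φ : Diffeomorph (𝓡 n) (𝓡 n) N N ∞} {z : N → ℝ}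
  {V : VField (𝓡 n) N} {g : Tensor2 (𝓡∂ (n + 1)) M} {ι : N → M}
  {L : ∀ p : N, TangentSpace (𝓡∂ (n + 1)) (ι p)}

theorem IsMatchingGauge.plusTensor_normal (h : IsMatchingGauge D D' φ z V)
    (hD : IsNullHypersurfaceData D) (hg : IsLorentzMetric g) (hE : IsEmbedded D' g ι L) (p : N) :
    plusTensor g ι L φ z V p (D.normal p) (D.normal p)
      = z p * (D'.pullback φ).Y p (D.normal p) (D.normal p)
          + 1 / z p * dScalar (𝓡 n) z p (D.normal p) := by
  have hφd : MDifferentiable (𝓡 n) (𝓡 n) φ := φ.contMDiff.mdifferentiable (by simp)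
  have hιd : MDifferentiable (𝓡 n) (𝓡∂ (n + 1)) ι := hE.smooth.mdifferentiable (by simp)
  have hf : ContMDiff (𝓡 n) (𝓡∂ (n + 1)) ∞ (fun q => ι (φ q)) := hE.smooth.comp φ.contMDiff
  have hchain : ∀ q, mfderiv (𝓡 n) (𝓡∂ (n + 1)) (fun q => ι (φ q)) q
      = (mfderiv (𝓡 n) (𝓡∂ (n + 1)) ι (φ q)).comp (mfderiv (𝓡 n) (𝓡 n) φ q) := fun q =>
    mfderiv_comp q (hιd _) (hφd q)
  have hpull : pullTensor2 (𝓡 n) (𝓡∂ (n + 1)) g (fun q => ι (φ q)) = D.γ := by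
    rw [← h.γ_pullback, hE.induced]
    funext q
    ext u v
    change g (ι (φ q)) (mfderiv (𝓡 n) (𝓡∂ (n + 1)) (fun q => ι (φ q)) q u)
      (mfderiv (𝓡 n) (𝓡∂ (n + 1)) (fun q => ι (φ q)) q v) = _
    rw [hchain]
    rfl
  have hrig : matchingRigging ι L φ z V
      = fun q => z q • (L (φ q) + mfderiv (𝓡 n) (𝓡∂ (n + 1)) (fun q => ι (φ q)) q (V q)) := by
    funext q
    rw [hchain]
    rfl
  have hLd : MDifferentiable (𝓡 n) (𝓡∂ (n + 1)).tangent
      (fun q => (⟨ι q, L q⟩ : TangentBundle (𝓡∂ (n + 1)) M)) :=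
    ContMDiff.mdifferentiable hE.smooth_rigging (by simp)
  have hL : MDifferentiableAt (𝓡 n) 𝓘(ℝ, EuclideanSpace ℝ (Fin (n + 1)))
      (vectorCoord (𝓡∂ (n + 1)) (fun q => ι (φ q)) (fun q => L (φ q)) (ι (φ p))) p :=
    mdifferentiableAt_vectorCoord (f := fun q => ι (φ q)) (ζ := fun q => L (φ q))
      (MDifferentiableAt.comp p (hLd (φ p)) (hφd p))
  have hVd : MDifferentiable (𝓡 n) (𝓡 n).tangent
      (fun q => (⟨q, V q⟩ : TangentBundle (𝓡 n) N)) :=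
    ContMDiff.mdifferentiable h.smooth_V (by simp)
  have hV := mdifferentiableAt_vectorCoord (f := fun q : N => q) (hVd p)
  have hfV := (hasMFDerivAt_vectorCoord_mfderiv hf hV.hasMFDerivAt).mdifferentiableAt
  have hsum := (HasMFDerivAt.vectorCoord_add (f := fun q => ι (φ q)) hL.hasMFDerivAt
    hfV.hasMFDerivAt).mdifferentiableAt
  have hz : MDifferentiableAt (𝓡 n) 𝓘(ℝ, ℝ) z p := h.smooth_z.mdifferentiable (by simp) p
  have hLn : g (ι (φ p)) (L (φ p))
      (mfderiv (𝓡 n) (𝓡∂ (n + 1)) (fun q => ι (φ q)) p (D.normal p)) = 1 / z p := by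
    rw [← h.ell_pullback_normal hD, hchain, hE.induced]
    rfl
  have hVn : g (ι (φ p)) (mfderiv (𝓡 n) (𝓡∂ (n + 1)) (fun q => ι (φ q)) p (V p))
      (mfderiv (𝓡 n) (𝓡∂ (n + 1)) (fun q => ι (φ q)) p (D.normal p)) = 0 := by
    change pullTensor2 (𝓡 n) (𝓡∂ (n + 1)) g (fun q => ι (φ q)) p (V p) (D.normal p) = 0
    rw [hpull, hD.symm_γ, hD.γ_normal]
    rfl
  have hξ : g (ι (φ p)) (L (φ p) + mfderiv (𝓡 n) (𝓡∂ (n + 1)) (fun q => ι (φ q)) p (V p))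
      (mfderiv (𝓡 n) (𝓡∂ (n + 1)) (fun q => ι (φ q)) p (D.normal p)) = 1 / z p := by
    rw [map_add, add_apply, hLn, hVn, add_zero]
  have hT : DifferentiableWithinAt ℝ (tensorCoord (𝓡∂ (n + 1)) g (ι (φ p))) (range (𝓡∂ (n + 1)))
      (extChartAt (𝓡∂ (n + 1)) (ι (φ p)) (ι (φ p))) :=
    (hg.smooth.contDiffWithinAt_tensorCoord _).differentiableWithinAt (by simp)
  have hS : DifferentiableAt ℝ (tensorCoord (𝓡 n) D.γ p) (extChartAt (𝓡 n) p p) := by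
    have := hD.smooth_γ.contDiffWithinAt_tensorCoord p
    rw [(𝓡 n).range_eq_univ, contDiffWithinAt_univ] at this
    exact this.differentiableAt (by simp)
  have htan : lieDerivAlong (𝓡 n) (𝓡∂ (n + 1)) g (fun q => ι (φ q))
      (fun q => mfderiv (𝓡 n) (𝓡∂ (n + 1)) (fun q => ι (φ q)) q (V q)) p (D.normal p) (D.normal p)
      = 0 := by
    rw [lieDerivAlong_mfderiv hf hT (by rwa [hpull]) hV, hpull, hD.lieDeriv_γ_normal]
  have hY : lieDerivAlong (𝓡 n) (𝓡∂ (n + 1)) g (fun q => ι (φ q)) (fun q => L (φ q)) p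
      (D.normal p) (D.normal p) = 2 * (D'.pullback φ).Y p (D.normal p) (D.normal p) := by
    rw [lieDerivAlong_comp (hφd p) (hιd _) (hLd _), hE.induced]
    change lieDerivAlong (𝓡 n) (𝓡∂ (n + 1)) g ι L (φ p) (mfderiv (𝓡 n) (𝓡 n) φ p (D.normal p))
        (mfderiv (𝓡 n) (𝓡 n) φ p (D.normal p))
      = 2 * (1 / 2 * lieDerivAlong (𝓡 n) (𝓡∂ (n + 1)) g ι L (φ p)
        (mfderiv (𝓡 n) (𝓡 n) φ p (D.normal p)) (mfderiv (𝓡 n) (𝓡 n) φ p (D.normal p)))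
    ring
  have hlie := lieDerivAlong_smul_apply (T := g) hsum hz (D.normal p) (D.normal p)
  rw [lieDerivAlong_add_apply (f := fun q => ι (φ q)) hL hfV, hY, htan, hξ, hg.symm, hξ] at hlie
  change 1 / 2 * lieDerivAlong (𝓡 n) (𝓡∂ (n + 1)) g (fun q => ι (φ q)) (matchingRigging ι L φ z V) p
    (D.normal p) (D.normal p) = _
  rw [hrig, hlie]
  ring

end Matching

end NullShell

end

open NullShell in
theorem lemma4p10 {n : ℕ}
    {N : Type*} [TopologicalSpace N] [ChartedSpace (EuclideanSpace ℝ (Fin n)) N]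
    [IsManifold (𝓡 n) ∞ N]
    {Mm : Type*} [TopologicalSpace Mm] [ChartedSpace (EuclideanHalfSpace (n + 1)) Mm]
    [IsManifold (𝓡∂ (n + 1)) ∞ Mm]
    {Mp : Type*} [TopologicalSpace Mp] [ChartedSpace (EuclideanHalfSpace (n + 1)) Mp]
    [IsManifold (𝓡∂ (n + 1)) ∞ Mp]
    -- the two spacetimes with boundary
    (gm : Tensor2 (𝓡∂ (n + 1)) Mm) (hgm : IsLorentzMetric gm)
    (gp : Tensor2 (𝓡∂ (n + 1)) Mp) (hgp : IsLorentzMetric gp)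
    -- the two embedded null hypersurface data `D` and `Dhat`
    (D Dhat : HypersurfaceData n N)
    (hD : IsNullHypersurfaceData D) (hDhat : IsNullHypersurfaceData Dhat)
    (ιm : N → Mm) (Lm : ∀ p : N, TangentSpace (𝓡∂ (n + 1)) (ιm p))
    (ιp : N → Mp) (Lp : ∀ p : N, TangentSpace (𝓡∂ (n + 1)) (ιp p))
    (hm : IsEmbedded D gm ιm Lm) (hp : IsEmbedded Dhat gp ιp Lp)
    (hbm : Set.range ιm = (𝓡∂ (n + 1)).boundary Mm)
    (hbp : Set.range ιp = (𝓡∂ (n + 1)).boundary Mp)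
    -- the orientation signs of the riggings
    (εm εp : ℝ) (hεm : IsRiggingSign ιm Lm εm) (hεp : IsRiggingSign ιp Lp εp)
    -- the matching conditions (i) and (ii)
    (φ : Diffeomorph (𝓡 n) (𝓡 n) N N ∞) (z : N → ℝ) (V : VField (𝓡 n) N)
    (hmatch : IsMatchingGauge D Dhat φ z V)
    (hsign : ∀ p, Real.sign (z p) = -(Real.sign εp * Real.sign εm))
    -- an arbitrary vector field
    (Vbar : VField (𝓡 n) N) (hVbar : SmoothVField (𝓡 n) Vbar) :
    (∀ p, z p = 1 / (Dhat.pullback φ).ell p (D.normal p)) ∧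
    (∀ p, pressure D (plusTensor gp ιp Lp φ z V) εm p =
      -εm * (D.surfaceGravity p - ((Dhat.pullback φ).gauge z Vbar).surfaceGravity p)) ∧
    (∀ p, pressure D (plusTensor gp ιp Lp φ z V) εm p =
      -εm * (D.surfaceGravity p - pushSurfaceGravity D Dhat φ z p)) ∧
    (∀ p, pressure D (plusTensor gp ιp Lp φ z V) εm p = 0 ↔
      ((Dhat.pullback φ).gauge z Vbar).surfaceGravity p = D.surfaceGravity p) ∧
    (∀ p, pressure D (plusTensor gp ιp Lp φ z V) εm p = 0 ↔
      pushSurfaceGravity D Dhat φ z p = D.surfaceGravity p) := by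
  have hP := hmatch.plusTensor_normal hD hgp hp
  have hG := hmatch.surfaceGravity_gauge hD Vbar
  have hS := hmatch.pushSurfaceGravity_eq hD hDhat
  have hpress : ∀ p κ, κ = -plusTensor gp ιp Lp φ z V p (D.normal p) (D.normal p) →
      pressure D (plusTensor gp ιp Lp φ z V) εm p = -εm * (D.surfaceGravity p - κ) := by
    rintro p κ rfl
    simp only [pressure, HypersurfaceData.surfaceGravity, sub_apply]
    ring
  have hε : εm ≠ 0 := by
    rcases hεm with ⟨rfl, -⟩ | ⟨rfl, -⟩ <;> norm_num
  have hzero : ∀ a b : ℝ, -εm * (a - b) = 0 ↔ b = a := fun a b => by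
    simp [hε, sub_eq_zero, eq_comm]
  have h2 : ∀ p, pressure D (plusTensor gp ιp Lp φ z V) εm p =
      -εm * (D.surfaceGravity p - ((Dhat.pullback φ).gauge z Vbar).surfaceGravity p) :=
    fun p => hpress p _ (by rw [hP, hG])
  have h3 : ∀ p, pressure D (plusTensor gp ιp Lp φ z V) εm p =
      -εm * (D.surfaceGravity p - pushSurfaceGravity D Dhat φ z p) :=
    fun p => hpress p _ (by rw [hP, hS])
  refine ⟨fun p => ?_, h2, h3, fun p => ?_, fun p => ?_⟩
  · rw [hmatch.ell_pullback_normal hD, one_div_one_div]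
  · rw [h2, hzero]
  · rw [h3, hzero]
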